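/- **Setting.** Let $V_1,V_2$ be non-zero separable complex Hilbert spaces and, for $i\in\{1,2\}$, let $P_{i},Q_{i}$ be orthogonal projections on $V_i$. Put $A_1=2P_1-\mathrm{id}$, $A_2=2Q_1-\mathrm{id}$ on $V_1$ and $B_1=2P_2-\mathrm{id}$, $B_2=2Q_2-\mathrm{id}$ on $V_2$. The Bell-CHSH operator on the Hilbert space tensor product $V_1\otimes V_2$ is $$\mathcal B=A_1\otimes(B_1+B_2)+A_2\otimes(B_1-B_2),$$ and $\rho(\mathcal B)$ is its spectral radius. Put $b(\lambda)=|\lambda|\sqrt{4-\lambda^2}$ for $\lambda\in[-2,2]$. **Assumption and approximations.** Let $(V,P,Q)$ be $(V_1,P_1,Q_1)$ or $(V_2,P_2,Q_2)$. Assume that one of the following holds, and let $\mathcal A=\{(V^{(n)},P^{(n)},Q^{(n)})\}_{n\ge1}$ be the approximation described there. * Case 1: $V$ is the orthogonal (Hilbert) direct sum of an at most countable family $(W_j)_{j\in J}$ of finite-dimensional subspaces invariant under $P$ and $Q$. Then, for some such family and some increasing sequence of finite sets $J_1\subset J_2\subset\cdots$ with union $J$, $V^{(n)}=\bigoplus_{j\in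 J_n}W_j$, and $P^{(n)},Q^{(n)}$ are the restrictions of $P,Q$ to $V^{(n)}$. * Case 2: Case 1 fails and $(P,Q)$ has a one-shifted form: there are an orthonormal basis $e_1,e_2,\dots$ of $V$ and angles $\theta_1,\theta_2,\dots\in(0,\pi)$ such that, with $R(\theta)=\frac12\begin{pmatrix}1+\cos\theta&\sin\theta\\ \sin\theta&1-\cos\theta\end{pmatrix}$, $P$ acts on $\mathrm{span}(e_{2k-1},e_{2k})$ by $R(\theta_{2k-1})$ for all $k\ge1$, while $Qe_1=e_1$ and $Q$ acts on $\mathrm{span}(e_{2k},e_{2k+1})$ by $R(\theta_{2k})$ for all $k\ge1$. Then, for some such basis, $V^{(n)}=\mathrm{span}(e_1,\dots,e_{2n})$, $P^{(n)}=P|_{V^{(n)}}$, and $Q^{(n)}e_j=Qe_j$ for $j<2n$, $Q^{(n)}e_{2n}=0$. Write $S=2(P+Q-\mathrm{id})$ and $S^{(n)}=2(P^{(n)}+Q^{(n)}-\mathrm{id})$. The finite dimensional approximate point spectrum of $S$ is the set of limits $\lambda=\lim\lambda^{(n)}$ of eigenvalues $\lambda^{(n)}$ of $S^{(n)}$ that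 have unit eigenvectors $u^{(n)}\in V^{(n)}$ with $\|Su^{(n)}-S^{(n)}u^{(n)}\|\to0$ (all for sufficiently large $n$). Let $F(S)$ be the set of $\lambda\in(0,2)$ such that both $\lambda$ and $-\lambda$ are in it, and let $\tilde F(S)=F(S)\cup\{0\}$. For $i\in\{1,2\}$ and all large $n$, let $\lambda_{i,n}$ be an eigenvalue of $S^{(n)}$ for the side $i$ whose square is closest to $2$ among all eigenvalues of $S^{(n)}$ (so $b(\lambda_{i,n})$ is the largest value of $b$ on the eigenvalues of $S^{(n)}$). **Theorem.** $$\sup_{\lambda\in\tilde F(A_1+A_2),\ \lambda'\in\tilde F(B_1+B_2)}\sqrt{4+b(\lambda)b(\lambda')}\ \le\ \rho(\mathcal B)\ \le\ \liminf_{n\to\infty}\sqrt{4+b(\lambda_{1,n})\,b(\lambda_{2,n})}.$$ -/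

import Mathlib

open Filter Topology TensorProduct

noncomputable section

namespace BellCHSH

variable {V : Type*} [NormedAddCommGroup V] [InnerProductSpace ℂ V]

/-- The reflection (dichotomic observable) `2P - id` attached to a projection `P`. -/
def reflection (P : V →L[ℂ] V) : V →L[ℂ] V := (2 : ℂ) • P - ContinuousLinearMap.id ℂ V

/-- The operator `A + B`, where `A = 2P - id` and `B = 2Q - id`. -/
def sumOp (P Q : V →L[ℂ] V) : V →L[ℂ] V := reflection P + reflection Q

/-- The function `b(λ) = |λ| √(4 - λ²)`, used for `λ ∈ [-2, 2]`. -/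
def b (l : ℝ) : ℝ := |l| * √(4 - l ^ 2)

/-- A finite dimensional subspace of `V` together with two orthogonal projections on it:
one term `(Vₙ, {Pₙ, Qₙ})` of a finite dimensional approximation. -/
structure FiniteDimPair (V : Type*) [NormedAddCommGroup V] [InnerProductSpace ℂ V] where
  space : Submodule ℂ V
  finiteDimensional : FiniteDimensional ℂ space
  P : space →ₗ[ℂ] space
  Q : space →ₗ[ℂ] space
  isSymmetricProjection_P : P.IsSymmetricProjection
  isSymmetricProjection_Q : Q.IsSymmetricProjection

/-- The operator `Aₙ + Bₙ` on `Vₙ`, where `Aₙ = 2Pₙ - id` and `Bₙ = 2Qₙ - id`. -/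
def FiniteDimPair.sumOp (X : FiniteDimPair V) : X.space →ₗ[ℂ] X.space :=
  ((2 : ℂ) • X.P - LinearMap.id) + ((2 : ℂ) • X.Q - LinearMap.id)

/-- `V` is the Hilbert space direct sum of the pairwise orthogonal, finite dimensional subspaces
`W i`, and each of them is invariant under `P` and `Q`. -/
structure IsInvariantDecomposition (P Q : V →L[ℂ] V) {ι : Type} (W : ι → Submodule ℂ V) :
    Prop where
  orthogonal : OrthogonalFamily ℂ (fun i => W i) (fun i => (W i).subtypeₗᵢ)
  dense : (⨆ i, W i).topologicalClosure = ⊤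
  finiteDimensional : ∀ i, FiniteDimensional ℂ (W i)
  map_P : ∀ i, ∀ x ∈ W i, P x ∈ W i
  map_Q : ∀ i, ∀ x ∈ W i, Q x ∈ W i

/-- The pair `(P, Q)` decomposes into at most countably many finite dimensional
invariant pieces. -/
def DecomposesFinitely (P Q : V →L[ℂ] V) : Prop :=
  ∃ (ι : Type) (_ : Countable ι) (W : ι → Submodule ℂ V), IsInvariantDecomposition P Q W

/-- The approximation attached to an orthogonal decomposition `W` into finite dimensional
invariant subspaces and to finite sets `I n` of indices: `Vₙ` is the sum of the `W i`, `i ∈ I n`,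
and `Pₙ`, `Qₙ` are the restrictions of `P`, `Q`. -/
structure IsDecompositionApprox (P Q : V →L[ℂ] V) {ι : Type} (W : ι → Submodule ℂ V)
    (I : ℕ → Finset ι) (𝒜 : ℕ → FiniteDimPair V) : Prop where
  monotone : Monotone I
  exhaust : ∀ i, ∃ n, i ∈ I n
  space_eq : ∀ n, (𝒜 n).space = ⨆ i ∈ I n, W i
  P_apply : ∀ n (x : (𝒜 n).space), ((𝒜 n).P x : V) = P x
  Q_apply : ∀ n (x : (𝒜 n).space), ((𝒜 n).Q x : V) = Q x

/-- `T` acts on the pair of vectors `(x, y)` through the rank one projection matrix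
`½ [[1 + cos t, sin t], [sin t, 1 - cos t]]`, so that `2T - id` acts through
`[[cos t, sin t], [sin t, -cos t]]`. -/
def ActsAsBlock (T : V →L[ℂ] V) (t : ℝ) (x y : V) : Prop :=
  T x = (((1 + Real.cos t) / 2 : ℝ) : ℂ) • x + ((Real.sin t / 2 : ℝ) : ℂ) • y ∧
  T y = ((Real.sin t / 2 : ℝ) : ℂ) • x + (((1 - Real.cos t) / 2 : ℝ) : ℂ) • y

/-- `(P, Q)` is in one-shifted form with respect to the orthonormal basis `e₀, e₁, e₂, …` with
angles `θ₀, θ₁, … ∈ (0, π)`: `P` is the direct sum of `2 × 2` blocks on `(e₀, e₁), (e₂, e₃), …`,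
whereas `Q` fixes `e₀` and is the direct sum of `2 × 2` blocks on `(e₁, e₂), (e₃, e₄), …`. -/
structure IsOneShifted (P Q : V →L[ℂ] V) (e : HilbertBasis ℕ ℂ V) (θ : ℕ → ℝ) : Prop where
  angle_mem : ∀ k, θ k ∈ Set.Ioo 0 Real.pi
  P_block : ∀ k, ActsAsBlock P (θ (2 * k)) (e (2 * k)) (e (2 * k + 1))
  Q_zero : Q (e 0) = e 0
  Q_block : ∀ k, ActsAsBlock Q (θ (2 * k + 1)) (e (2 * k + 1)) (e (2 * k + 2))

/-- The approximation attached to a one-shifted form: the `n`-th space (`n = 0, 1, 2, …`) is spanned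
by the first `2(n+1)` basis vectors, `Pₙ` is the restriction of `P` to it, and `Qₙ` agrees with `Q`
on all these basis vectors but the last one, which `Qₙ` sends to `0`. -/
structure IsOneShiftedApprox (P Q : V →L[ℂ] V) (e : HilbertBasis ℕ ℂ V)
    (𝒜 : ℕ → FiniteDimPair V) : Prop where
  space_eq : ∀ n, (𝒜 n).space = Submodule.span ℂ (e '' {j | j < 2 * (n + 1)})
  P_apply : ∀ n (x : (𝒜 n).space), ((𝒜 n).P x : V) = P x
  Q_apply : ∀ n, ∀ j < 2 * n + 1, ∀ x : (𝒜 n).space, (x : V) = e j → ((𝒜 n).Q x : V) = Q (e j)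
  Q_last : ∀ n, ∀ x : (𝒜 n).space, (x : V) = e (2 * n + 1) → (𝒜 n).Q x = 0

/-- `(V, {P, Q})` falls under one of the two cases and `𝒜` is the approximation belonging to that
case: the pair decomposes into finite dimensional invariant pieces and `𝒜` is given by such a
decomposition, or it does not so decompose but has a one-shifted form, and `𝒜` is given by such
a form. -/
inductive IsCanonicalApprox (P Q : V →L[ℂ] V) (𝒜 : ℕ → FiniteDimPair V) : Prop
  | decomposition (ι : Type) (hι : Countable ι) (W : ι → Submodule ℂ V) (I : ℕ → Finset ι)
      (hW : IsInvariantDecomposition P Q W) (h𝒜 : IsDecompositionApprox P Q W I 𝒜) :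
      IsCanonicalApprox P Q 𝒜
  | oneShifted (hPQ : ¬ DecomposesFinitely P Q) (e : HilbertBasis ℕ ℂ V) (θ : ℕ → ℝ)
      (he : IsOneShifted P Q e θ) (h𝒜 : IsOneShiftedApprox P Q e 𝒜) :
      IsCanonicalApprox P Q 𝒜

/-- The (real) finite dimensional approximate point spectrum of `A + B` corresponding to `𝒜`:
the limits `l` of eigenvalues `lₙ` of `Aₙ + Bₙ` for which there are unit eigenvectors `uₙ ∈ Vₙ` with
`‖(A + B) uₙ - (Aₙ + Bₙ) uₙ‖ → 0`. Only large `n` matter, as `Vₙ` may be zero for small `n`. -/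
def finDimApproxPointSpectrum (P Q : V →L[ℂ] V) (𝒜 : ℕ → FiniteDimPair V) : Set ℝ :=
  {l | ∃ (lam : ℕ → ℝ) (u : ∀ n, (𝒜 n).space),
    (∀ᶠ n in atTop, ‖u n‖ = 1 ∧ (𝒜 n).sumOp (u n) = (lam n : ℂ) • u n) ∧
    Tendsto lam atTop (𝓝 l) ∧
    Tendsto (fun n => ‖sumOp P Q (u n : V) - ((𝒜 n).sumOp (u n) : V)‖) atTop (𝓝 0)}

/-- The set `F(A + B)` of all `l ∈ (0, 2)` such that `l` and `-l` belong to the finite dimensional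
approximate point spectrum of `A + B`. -/
def F (P Q : V →L[ℂ] V) (𝒜 : ℕ → FiniteDimPair V) : Set ℝ :=
  {l | l ∈ Set.Ioo 0 2 ∧ l ∈ finDimApproxPointSpectrum P Q 𝒜 ∧
    -l ∈ finDimApproxPointSpectrum P Q 𝒜}

/-- The set `F̃(A + B) = F(A + B) ∪ {0}`. -/
def Ftilde (P Q : V →L[ℂ] V) (𝒜 : ℕ → FiniteDimPair V) : Set ℝ := F P Q 𝒜 ∪ {0}

/-- `l` is an eigenvalue of `Aₙ + Bₙ` whose square is closest to `2`, i.e. whose absolute value is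
closest to `√2`, distances being measured between the squares. -/
def IsNearestEigenvalue (X : FiniteDimPair V) (l : ℝ) : Prop :=
  Module.End.HasEigenvalue X.sumOp (l : ℂ) ∧
    ∀ m : ℝ, Module.End.HasEigenvalue X.sumOp (m : ℂ) → |l ^ 2 - 2| ≤ |m ^ 2 - 2|

variable {W : Type*} [NormedAddCommGroup W] [InnerProductSpace ℂ W]

/-- The Hilbert space tensor product: the completion of the algebraic tensor product for the inner
product with `⟪v ⊗ w, v' ⊗ w'⟫ = ⟪v, v'⟫ ⟪w, w'⟫`. -/
abbrev HilbertTensor (V W : Type*) [NormedAddCommGroup V] [InnerProductSpace ℂ V]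
    [NormedAddCommGroup W] [InnerProductSpace ℂ W] : Type _ :=
  UniformSpace.Completion (V ⊗[ℂ] W)

/-- The bounded operator `S ⊗ T` on the Hilbert space tensor product. -/
def tensorOp (S : V →L[ℂ] V) (T : W →L[ℂ] W) : HilbertTensor V W →L[ℂ] HilbertTensor V W :=
  ((UniformSpace.Completion.toComplL (𝕜 := ℂ) (E := V ⊗[ℂ] W)).comp
    (TensorProduct.mapL S T)).extend UniformSpace.Completion.toComplL

theorem tensorOp_coe (S : V →L[ℂ] V) (T : W →L[ℂ] W) (x : V ⊗[ℂ] W) :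
    tensorOp S T (x : HilbertTensor V W) = (TensorProduct.mapL S T x : V ⊗[ℂ] W) :=
  ContinuousLinearMap.extend_eq _ UniformSpace.Completion.denseRange_coe
    (UniformSpace.Completion.isUniformInducing_coe _) x

/-- The Bell-CHSH operator `A₁ ⊗ (B₁ + B₂) + A₂ ⊗ (B₁ - B₂)`. -/
def bellCHSH (A₁ A₂ : V →L[ℂ] V) (B₁ B₂ : W →L[ℂ] W) :
    HilbertTensor V W →L[ℂ] HilbertTensor V W :=
  tensorOp A₁ (B₁ + B₂) + tensorOp A₂ (B₁ - B₂)

end BellCHSH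

end

/-!
Self-adjoint involutions `u`, `v` in a C⋆-algebra satisfy `⁅u, v⁆² = ((u + v)² - 2)² - 4`, so
`|⁅u, v⁆| = b(u + v)`: this is where the function `b` comes from. The square of the Bell-CHSH
operator is `4 - ⁅A₁, A₂⁆ ⊗ ⁅B₁, B₂⁆`. Since `A₁ ⊗ 1` anticommutes with `⁅A₁, A₂⁆ ⊗ ⁅B₁, B₂⁆`, the
spectrum of the latter is symmetric about zero, whence `ρ(𝓑)² = 4 + ‖⁅A₁, A₂⁆‖ ‖⁅B₁, B₂⁆‖`.

For the lower bound, limits of approximate eigenvalues lie in the spectrum of `A₁ + A₂`, on which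
`b` is at most `‖⁅A₁, A₂⁆‖`. For the upper bound, the commutators of the finite dimensional pairs,
extended by zero, converge strongly to `⁅A₁, A₂⁆`. The norm is lower semicontinuous for strong
convergence, and the norm of a finite dimensional commutator is the largest value of `b` on the
eigenvalues.
-/

noncomputable section

namespace BellCHSH

section Involutions

theorem lie_sq_of_sq_eq_one {R : Type*} [Ring R] {u v : R} (hu : u ^ 2 = 1) (hv : v ^ 2 = 1) :
    ⁅u, v⁆ ^ 2 = ((u + v) ^ 2 - 2) ^ 2 - 4 := by
  have hsum : (u + v) ^ 2 - 2 = u * v + v * u := by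
    rw [(by noncomm_ring : (u + v) ^ 2 = u ^ 2 + v ^ 2 + (u * v + v * u)), hu, hv,
      one_add_one_eq_two, add_sub_cancel_left]
  have huvvu : u * v * (v * u) = 1 := by
    rw [(by noncomm_ring : u * v * (v * u) = u * v ^ 2 * u), hv, mul_one, ← sq, hu]
  have hvuuv : v * u * (u * v) = 1 := by
    rw [(by noncomm_ring : v * u * (u * v) = v * u ^ 2 * v), hu, mul_one, ← sq, hv]
  calc ⁅u, v⁆ ^ 2
      = (u * v + v * u) ^ 2 - 2 * (u * v * (v * u) + v * u * (u * v)) := by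
        rw [Ring.lie_def]; noncomm_ring
    _ = ((u + v) ^ 2 - 2) ^ 2 - 4 := by rw [huvvu, hvuuv, hsum]; norm_num

theorem mul_lie_of_sq_eq_one {R : Type*} [Ring R] {u : R} (hu : u ^ 2 = 1) (v : R) :
    u * ⁅u, v⁆ = -(⁅u, v⁆ * u) := by
  calc u * ⁅u, v⁆ = u ^ 2 * v - u * v * u := by rw [Ring.lie_def]; noncomm_ring
    _ = v * u ^ 2 - u * v * u := by rw [hu, one_mul, mul_one]
    _ = -(⁅u, v⁆ * u) := by rw [Ring.lie_def]; noncomm_ring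

theorem star_lie_of_isSelfAdjoint {R : Type*} [Ring R] [StarRing R] {u v : R}
    (hu : IsSelfAdjoint u) (hv : IsSelfAdjoint v) : star ⁅u, v⁆ = -⁅u, v⁆ := by
  rw [Ring.lie_def, star_sub, star_mul, star_mul, hu.star_eq, hv.star_eq, neg_sub]

theorem b_eq_sqrt (l : ℝ) : b l = √(4 - (l ^ 2 - 2) ^ 2) := by
  rw [b, ← Real.sqrt_sq_eq_abs, ← Real.sqrt_mul (sq_nonneg l)]
  ring_nf

theorem b_nonneg (l : ℝ) : 0 ≤ b l := by
  rw [b_eq_sqrt]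
  exact Real.sqrt_nonneg _

theorem continuous_b : Continuous b := by
  unfold b
  fun_prop

theorem b_le_b_of_abs_sq_sub_two_le {l m : ℝ} (h : |l ^ 2 - 2| ≤ |m ^ 2 - 2|) : b m ≤ b l := by
  rw [b_eq_sqrt, b_eq_sqrt]
  exact Real.sqrt_le_sqrt (sub_le_sub_left (sq_le_sq.2 h) 4)

variable {A : Type*} [CStarAlgebra A]

theorem abs_lie_eq_cfc_b [PartialOrder A] [StarOrderedRing A] {u v : A} (hu : IsSelfAdjoint u)
    (hv : IsSelfAdjoint v) (hu_sq : u ^ 2 = 1) (hv_sq : v ^ 2 = 1) :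
    CFC.abs ⁅u, v⁆ = cfc b (u + v) := by
  have hs : IsSelfAdjoint (u + v) := hu.add hv
  have hstar_mul : star ⁅u, v⁆ * ⁅u, v⁆ = cfc (fun l : ℝ => 4 - (l ^ 2 - 2) ^ 2) (u + v) := by
    rw [star_lie_of_isSelfAdjoint hu hv, neg_mul, ← sq, lie_sq_of_sq_eq_one hu_sq hv_sq, neg_sub,
      cfc_sub .., cfc_pow .., cfc_sub .., cfc_pow_id .., cfc_const .., cfc_const ..]
    simp only [map_ofNat]
  rw [CFC.abs, CFC.sqrt_eq_real_sqrt _ (star_mul_self_nonneg _), cfcₙ_eq_cfc, hstar_mul,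
    ← cfc_comp' ..]
  simp only [← b_eq_sqrt]

theorem norm_lie_eq_norm_cfc_b {u v : A} (hu : IsSelfAdjoint u) (hv : IsSelfAdjoint v)
    (hu_sq : u ^ 2 = 1) (hv_sq : v ^ 2 = 1) : ‖⁅u, v⁆‖ = ‖cfc b (u + v)‖ := by
  let := CStarAlgebra.spectralOrder A
  have := CStarAlgebra.spectralOrderedRing A
  rw [← abs_lie_eq_cfc_b hu hv hu_sq hv_sq, CFC.norm_abs]

end Involutions

section CHSH

theorem chsh_sq {R : Type*} [Ring R] {a₁ a₂ b₁ b₂ : R} (ha₁ : a₁ ^ 2 = 1) (ha₂ : a₂ ^ 2 = 1)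
    (hb₁ : b₁ ^ 2 = 1) (hb₂ : b₂ ^ 2 = 1) (h₁₁ : Commute a₁ b₁) (h₁₂ : Commute a₁ b₂)
    (h₂₁ : Commute a₂ b₁) (h₂₂ : Commute a₂ b₂) :
    (a₁ * (b₁ + b₂) + a₂ * (b₁ - b₂)) ^ 2 = 4 - ⁅a₁, a₂⁆ * ⁅b₁, b₂⁆ := by
  have hsum : (b₁ + b₂) ^ 2 + (b₁ - b₂) ^ 2 = 4 := by
    rw [(by noncomm_ring : (b₁ + b₂) ^ 2 + (b₁ - b₂) ^ 2 = 2 * b₁ ^ 2 + 2 * b₂ ^ 2), hb₁, hb₂]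
    norm_num
  have hadd_sub : (b₁ + b₂) * (b₁ - b₂) = -⁅b₁, b₂⁆ := by
    rw [(by rw [Ring.lie_def]; noncomm_ring :
      (b₁ + b₂) * (b₁ - b₂) = b₁ ^ 2 - b₂ ^ 2 - ⁅b₁, b₂⁆), hb₁, hb₂, sub_self, zero_sub]
  have hsub_add : (b₁ - b₂) * (b₁ + b₂) = ⁅b₁, b₂⁆ := by
    rw [(by rw [Ring.lie_def]; noncomm_ring :
      (b₁ - b₂) * (b₁ + b₂) = b₁ ^ 2 - b₂ ^ 2 + ⁅b₁, b₂⁆), hb₁, hb₂, sub_self, zero_add]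
  have hadd₁ : Commute (b₁ + b₂) a₁ := (h₁₁.add_right h₁₂).symm
  have hadd₂ : Commute (b₁ + b₂) a₂ := (h₂₁.add_right h₂₂).symm
  have hsub₁ : Commute (b₁ - b₂) a₁ := (h₁₁.sub_right h₁₂).symm
  have hsub₂ : Commute (b₁ - b₂) a₂ := (h₂₁.sub_right h₂₂).symm
  calc (a₁ * (b₁ + b₂) + a₂ * (b₁ - b₂)) ^ 2
      = a₁ ^ 2 * (b₁ + b₂) ^ 2 + a₂ ^ 2 * (b₁ - b₂) ^ 2
        + (a₁ * a₂ * ((b₁ + b₂) * (b₁ - b₂)) + a₂ * a₁ * ((b₁ - b₂) * (b₁ + b₂))) := by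
        rw [sq, add_mul (a₁ * (b₁ + b₂)), mul_add (a₁ * (b₁ + b₂)), mul_add (a₂ * (b₁ - b₂)),
          hadd₁.mul_mul_mul_comm, hadd₂.mul_mul_mul_comm,
          hsub₁.mul_mul_mul_comm, hsub₂.mul_mul_mul_comm]
        simp only [sq]
        abel
    _ = 4 - ⁅a₁, a₂⁆ * ⁅b₁, b₂⁆ := by
        rw [ha₁, ha₂, one_mul, one_mul, hsum, hadd_sub, hsub_add, Ring.lie_def a₁]
        noncomm_ring

theorem norm_algebraMap_add_of_anticommute {A : Type*} [CStarAlgebra A] [Nontrivial A] {k : A}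
    (hk : IsSelfAdjoint k) {u : Aˣ} (huk : u * k = -(k * u)) {r : ℝ} (hr : 0 ≤ r) :
    ‖algebraMap ℝ A r + k‖ = r + ‖k‖ := by
  have hspec : ∀ l ∈ spectrum ℝ k, -l ∈ spectrum ℝ k := by
    intro l hl
    have hconj : (u : A) * k * (u⁻¹ : Aˣ) = -k := by
      rw [huk, neg_mul, mul_assoc, u.mul_inv, mul_one]
    rwa [← spectrum.units_conjugate (u := u), hconj, ← spectrum.neg_eq, Set.neg_mem_neg]
  have hnorm : ‖k‖ ∈ spectrum ℝ k :=
    (CStarAlgebra.norm_or_neg_norm_mem_spectrum hk).elim id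
      fun h => by simpa only [neg_neg] using hspec _ h
  refine le_antisymm ?_ ?_
  · calc ‖algebraMap ℝ A r + k‖ ≤ ‖algebraMap ℝ A r‖ + ‖k‖ := norm_add_le _ _
      _ = r + ‖k‖ := by rw [norm_algebraMap', Real.norm_of_nonneg hr]
  · have hmem : r + ‖k‖ ∈ spectrum ℝ (algebraMap ℝ A r + k) := by
      rwa [add_comm r, spectrum.add_mem_add_iff]
    exact (le_abs_self _).trans (spectrum.norm_le_norm_of_mem hmem)

theorem isSelfAdjoint_chsh {R : Type*} [Ring R] [StarRing R] {a₁ a₂ b₁ b₂ : R}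
    (h : IsCHSHTuple a₁ a₂ b₁ b₂) : IsSelfAdjoint (a₁ * (b₁ + b₂) + a₂ * (b₁ - b₂)) := by
  rw [IsSelfAdjoint]
  simp only [star_add, star_sub, star_mul, h.A₀_sa, h.A₁_sa, h.B₀_sa, h.B₁_sa, mul_add, mul_sub,
    h.A₀B₀_commutes, h.A₀B₁_commutes, h.A₁B₀_commutes, h.A₁B₁_commutes]

theorem norm_chsh_sq {A : Type*} [CStarAlgebra A] [Nontrivial A] {a₁ a₂ b₁ b₂ : A}
    (h : IsCHSHTuple a₁ a₂ b₁ b₂) :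
    ‖a₁ * (b₁ + b₂) + a₂ * (b₁ - b₂)‖ ^ 2 = 4 + ‖⁅a₁, a₂⁆ * ⁅b₁, b₂⁆‖ := by
  have hcomm (a : A) (h₁ : Commute a b₁) (h₂ : Commute a b₂) : Commute a ⁅b₁, b₂⁆ :=
    (h₁.mul_right h₂).sub_right (h₂.mul_right h₁)
  have hcomm₁ := hcomm a₁ h.A₀B₀_commutes h.A₀B₁_commutes
  have hcomm₂ := hcomm a₂ h.A₁B₀_commutes h.A₁B₁_commutes
  have hsa : IsSelfAdjoint (-(⁅a₁, a₂⁆ * ⁅b₁, b₂⁆)) := by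
    have : Commute ⁅a₁, a₂⁆ ⁅b₁, b₂⁆ :=
      (hcomm₁.mul_left hcomm₂).sub_left (hcomm₂.mul_left hcomm₁)
    rw [IsSelfAdjoint, star_neg, star_mul, star_lie_of_isSelfAdjoint h.A₀_sa h.A₁_sa,
      star_lie_of_isSelfAdjoint h.B₀_sa h.B₁_sa, neg_mul_neg, this.eq]
  have hanti : a₁ * -(⁅a₁, a₂⁆ * ⁅b₁, b₂⁆) = -(-(⁅a₁, a₂⁆ * ⁅b₁, b₂⁆) * a₁) := by
    rw [mul_neg, neg_inj, ← mul_assoc, mul_lie_of_sq_eq_one h.A₀_inv, neg_mul, neg_mul, mul_assoc,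
      hcomm₁.eq, mul_assoc]
  have hu : a₁ * a₁ = 1 := by rw [← sq, h.A₀_inv]
  have key := norm_algebraMap_add_of_anticommute hsa (u := ⟨a₁, a₁, hu, hu⟩) hanti zero_le_four
  rw [map_ofNat, ← sub_eq_add_neg, norm_neg] at key
  rw [← key, ← chsh_sq h.A₀_inv h.A₁_inv h.B₀_inv h.B₁_inv h.A₀B₀_commutes h.A₀B₁_commutes
    h.A₁B₀_commutes h.A₁B₁_commutes, sq (_ + _), (isSelfAdjoint_chsh h).norm_mul_self]

theorem spectralRadius_chsh {A : Type*} [CStarAlgebra A] [Nontrivial A] {a₁ a₂ b₁ b₂ : A}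
    (h : IsCHSHTuple a₁ a₂ b₁ b₂) :
    spectralRadius ℂ (a₁ * (b₁ + b₂) + a₂ * (b₁ - b₂))
      = ENNReal.ofReal √(4 + ‖⁅a₁, a₂⁆ * ⁅b₁, b₂⁆‖) := by
  rw [(isSelfAdjoint_chsh h).spectralRadius_eq_nnnorm, ← norm_chsh_sq h,
    Real.sqrt_sq (norm_nonneg _), ofReal_norm, enorm_eq_nnnorm]

end CHSH

section Reflections

variable {V : Type*} [NormedAddCommGroup V] [InnerProductSpace ℂ V]

theorem reflection_sq {P : V →L[ℂ] V} (hP : IsIdempotentElem P) : reflection P ^ 2 = 1 := by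
  have hP_eq (x : V) : P (P x) = P x := DFunLike.congr_fun hP.eq x
  ext x
  simp only [sq, mul_apply_eq_comp, reflection, sub_apply, smul_apply,
    ContinuousLinearMap.id_apply, map_sub, map_smul, hP_eq, one_apply_eq_self]
  module

variable [CompleteSpace V] {P Q : V →L[ℂ] V}

theorem isSelfAdjoint_reflection (hP : IsSelfAdjoint P) : IsSelfAdjoint (reflection P) :=
  .sub (.smul (.ofNat 2) hP) (.one _)

theorem norm_reflection_le_one (hP : IsStarProjection P) : ‖reflection P‖ ≤ 1 := by
  have hmem : reflection P ∈ unitary (V →L[ℂ] V) := by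
    rw [Unitary.mem_iff, (isSelfAdjoint_reflection hP.isSelfAdjoint).star_eq, ← sq,
      reflection_sq hP.isIdempotentElem, and_self]
  refine ContinuousLinearMap.opNorm_le_bound _ zero_le_one fun x => ?_
  rw [ContinuousLinearMap.norm_map_of_mem_unitary hmem, one_mul]

theorem norm_lie_reflection (hP : IsStarProjection P) (hQ : IsStarProjection Q) :
    ‖⁅reflection P, reflection Q⁆‖ = ‖cfc b (sumOp P Q)‖ :=
  norm_lie_eq_norm_cfc_b (isSelfAdjoint_reflection hP.isSelfAdjoint)
    (isSelfAdjoint_reflection hQ.isSelfAdjoint) (reflection_sq hP.isIdempotentElem)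
    (reflection_sq hQ.isIdempotentElem)

theorem isSelfAdjoint_sumOp (hP : IsSelfAdjoint P) (hQ : IsSelfAdjoint Q) :
    IsSelfAdjoint (sumOp P Q) :=
  (isSelfAdjoint_reflection hP).add (isSelfAdjoint_reflection hQ)

theorem b_le_norm_lie_reflection_of_mem_spectrum (hP : IsStarProjection P)
    (hQ : IsStarProjection Q) {l : ℝ} (hl : l ∈ spectrum ℝ (sumOp P Q)) :
    b l ≤ ‖⁅reflection P, reflection Q⁆‖ := by
  rw [norm_lie_reflection hP hQ]
  exact (Real.le_norm_self _).trans (norm_apply_le_norm_cfc b (sumOp P Q) hl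
    continuous_b.continuousOn (isSelfAdjoint_sumOp hP.isSelfAdjoint hQ.isSelfAdjoint))

end Reflections

section ApproximatePointSpectrum

theorem not_isUnit_of_tendsto_apply_zero {𝕜 E ι : Type*} [NontriviallyNormedField 𝕜]
    [NormedAddCommGroup E] [NormedSpace 𝕜 E] {l : Filter ι} [l.NeBot] {T : E →L[𝕜] E} {u : ι → E}
    (hu : ∀ᶠ i in l, ‖u i‖ = 1) (hTu : Tendsto (fun i => T (u i)) l (𝓝 0)) : ¬IsUnit T := by
  rintro ⟨T, rfl⟩
  have hu_zero : Tendsto u l (𝓝 0) := by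
    have := ((T⁻¹ : (E →L[𝕜] E)ˣ) : E →L[𝕜] E).continuous.tendsto 0 |>.comp hTu
    rw [map_zero] at this
    refine this.congr fun i => ?_
    rw [Function.comp_apply, ← mul_apply_eq_comp, T.inv_mul, one_apply_eq_self]
  have hu_one : Tendsto (fun i => ‖u i‖) l (𝓝 1) :=
    tendsto_const_nhds.congr' (hu.mono fun _ h => h.symm)
  exact zero_ne_one (tendsto_nhds_unique (by simpa only [norm_zero] using hu_zero.norm) hu_one)

variable {V : Type*} [NormedAddCommGroup V] [InnerProductSpace ℂ V] {P Q : V →L[ℂ] V}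
  {𝒜 : ℕ → FiniteDimPair V}

theorem finDimApproxPointSpectrum_subset_spectrum :
    finDimApproxPointSpectrum P Q 𝒜 ⊆ spectrum ℝ (sumOp P Q) := by
  rintro l ⟨lam, u, hu, hlam, hlim⟩
  refine not_isUnit_of_tendsto_apply_zero (hu.mono fun n h => h.1) ?_
  have hbound : Tendsto (fun n => |l - lam n| + ‖sumOp P Q (u n : V) - ((𝒜 n).sumOp (u n) : V)‖)
      atTop (𝓝 0) := by
    simpa only [sub_self, abs_zero, add_zero] using (hlam.const_sub l).abs.add hlim
  refine squeeze_zero_norm' ?_ hbound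
  filter_upwards [hu] with n ⟨hn, hlam_n⟩
  calc ‖(algebraMap ℝ (V →L[ℂ] V) l - sumOp P Q) (u n)‖
      = ‖((l - lam n : ℝ) : ℂ) • (u n : V)
          - (sumOp P Q (u n) - ((𝒜 n).sumOp (u n) : V))‖ := by
        rw [hlam_n, sub_apply, ContinuousLinearMap.algebraMap_apply, Submodule.coe_smul]
        congr 1
        push_cast
        module
    _ ≤ |l - lam n| + ‖sumOp P Q (u n) - ((𝒜 n).sumOp (u n) : V)‖ := by
        refine (norm_sub_le _ _).trans_eq ?_
        rw [norm_smul, Complex.norm_real, ← Submodule.coe_norm, hn, mul_one, Real.norm_eq_abs]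

theorem Ftilde_subset : Ftilde P Q 𝒜 ⊆ insert 0 (finDimApproxPointSpectrum P Q 𝒜) := by
  rw [Ftilde, Set.union_singleton]
  exact Set.insert_subset_insert fun _ hl => hl.2.1

theorem b_le_norm_lie_reflection [CompleteSpace V] (hP : IsStarProjection P)
    (hQ : IsStarProjection Q) {l : ℝ} (hl : l ∈ insert 0 (finDimApproxPointSpectrum P Q 𝒜)) :
    b l ≤ ‖⁅reflection P, reflection Q⁆‖ := by
  rcases hl with rfl | hl
  · simp only [b, abs_zero, zero_mul, norm_nonneg]
  · exact b_le_norm_lie_reflection_of_mem_spectrum hP hQ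
      (finDimApproxPointSpectrum_subset_spectrum hl)

end ApproximatePointSpectrum

section Tensor

variable {V W : Type*} [NormedAddCommGroup V] [InnerProductSpace ℂ V]
  [NormedAddCommGroup W] [InnerProductSpace ℂ W]

theorem hilbertTensor_clm_ext {f g : HilbertTensor V W →L[ℂ] HilbertTensor V W}
    (h : ∀ (x : V) (y : W), f ((x ⊗ₜ[ℂ] y : V ⊗[ℂ] W) : HilbertTensor V W)
      = g ((x ⊗ₜ[ℂ] y : V ⊗[ℂ] W) : HilbertTensor V W)) : f = g := by
  ext z
  induction z using UniformSpace.Completion.induction_on with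
  | hp => exact isClosed_eq f.continuous g.continuous
  | ih t =>
    induction t using TensorProduct.induction_on with
    | zero => rw [UniformSpace.Completion.coe_zero, map_zero, map_zero]
    | tmul x y => exact h x y
    | add s t hs ht => rw [UniformSpace.Completion.coe_add, map_add, map_add, hs, ht]

theorem tensorOp_tmul (S : V →L[ℂ] V) (T : W →L[ℂ] W) (x : V) (y : W) :
    tensorOp S T ((x ⊗ₜ[ℂ] y : V ⊗[ℂ] W) : HilbertTensor V W)
      = ((S x ⊗ₜ[ℂ] T y : V ⊗[ℂ] W) : HilbertTensor V W) := by
  rw [tensorOp_coe, TensorProduct.mapL_tmul]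

theorem tensorOp_mul (S S' : V →L[ℂ] V) (T T' : W →L[ℂ] W) :
    tensorOp S T * tensorOp S' T' = tensorOp (S * S') (T * T') :=
  hilbertTensor_clm_ext fun x y => by
    simp only [mul_apply_eq_comp, tensorOp_tmul]

theorem tensorOp_one_one : tensorOp (1 : V →L[ℂ] V) (1 : W →L[ℂ] W) = 1 :=
  hilbertTensor_clm_ext fun x y => by
    simp only [one_apply_eq_self, tensorOp_tmul]

theorem tensorOp_add_right (S : V →L[ℂ] V) (T T' : W →L[ℂ] W) :
    tensorOp S (T + T') = tensorOp S T + tensorOp S T' :=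
  hilbertTensor_clm_ext fun x y => by
    simp only [add_apply, tensorOp_tmul, TensorProduct.tmul_add,
      UniformSpace.Completion.coe_add]

theorem tensorOp_sub_right (S : V →L[ℂ] V) (T T' : W →L[ℂ] W) :
    tensorOp S (T - T') = tensorOp S T - tensorOp S T' :=
  hilbertTensor_clm_ext fun x y => by
    simp only [sub_apply, tensorOp_tmul, TensorProduct.tmul_sub,
      UniformSpace.Completion.coe_sub]

theorem tensorOp_sub_left (S S' : V →L[ℂ] V) (T : W →L[ℂ] W) :
    tensorOp (S - S') T = tensorOp S T - tensorOp S' T :=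
  hilbertTensor_clm_ext fun x y => by
    simp only [sub_apply, tensorOp_tmul, TensorProduct.sub_tmul,
      UniformSpace.Completion.coe_sub]

theorem commute_tensorOp_one_one_tensorOp (S : V →L[ℂ] V) (T : W →L[ℂ] W) :
    Commute (tensorOp S 1) (tensorOp 1 T) := by
  rw [Commute, SemiconjBy, tensorOp_mul, tensorOp_mul, mul_one, one_mul, mul_one, one_mul]

theorem lie_tensorOp_one_mul_lie_one_tensorOp (S S' : V →L[ℂ] V) (T T' : W →L[ℂ] W) :
    ⁅tensorOp S (1 : W →L[ℂ] W), tensorOp S' 1⁆ * ⁅tensorOp (1 : V →L[ℂ] V) T, tensorOp 1 T'⁆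
      = tensorOp ⁅S, S'⁆ ⁅T, T'⁆ := by
  simp only [Ring.lie_def, tensorOp_mul, mul_one, ← tensorOp_sub_left, ← tensorOp_sub_right,
    one_mul]

theorem star_tensorOp [CompleteSpace V] [CompleteSpace W] (S : V →L[ℂ] V) (T : W →L[ℂ] W) :
    star (tensorOp S T) = tensorOp (star S) (star T) := by
  refine ((ContinuousLinearMap.eq_adjoint_iff (tensorOp (star S) (star T)) (tensorOp S T)).2
    fun z w => ?_).symm
  induction z, w using UniformSpace.Completion.induction_on₂ with
  | hp => exact isClosed_eq (by fun_prop) (by fun_prop)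
  | ih s t =>
    simp only [tensorOp_coe, UniformSpace.Completion.inner_coe]
    induction s using TensorProduct.induction_on with
    | zero => simp only [map_zero, inner_zero_left]
    | add s s' hs hs' => rw [map_add, inner_add_left, inner_add_left, hs, hs']
    | tmul x y =>
      induction t using TensorProduct.induction_on with
      | zero => simp only [map_zero, inner_zero_right]
      | add t t' ht ht' => rw [map_add, inner_add_right, inner_add_right, ht, ht']
      | tmul x' y' =>
        simp only [TensorProduct.mapL_tmul, TensorProduct.inner_tmul,
          ContinuousLinearMap.star_eq_adjoint, ContinuousLinearMap.adjoint_inner_left]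

theorem norm_tensorOp (S : V →L[ℂ] V) (T : W →L[ℂ] W) : ‖tensorOp S T‖ = ‖S‖ * ‖T‖ := by
  refine le_antisymm (ContinuousLinearMap.opNorm_le_bound _ (by positivity) fun z => ?_) ?_
  · induction z using UniformSpace.Completion.induction_on with
    | hp => exact isClosed_le (by fun_prop) (by fun_prop)
    | ih t =>
      rw [tensorOp_coe, UniformSpace.Completion.norm_coe, UniformSpace.Completion.norm_coe]
      exact (TensorProduct.mapL S T).le_of_opNorm_le (TensorProduct.norm_mapL_le S T) t
  · have hsimple (x : V) (y : W) : ‖S x‖ * ‖T y‖ ≤ ‖tensorOp S T‖ * ‖x‖ * ‖y‖ := by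
      have := (tensorOp S T).le_opNorm ((x ⊗ₜ[ℂ] y : V ⊗[ℂ] W) : HilbertTensor V W)
      rwa [tensorOp_tmul, UniformSpace.Completion.norm_coe, UniformSpace.Completion.norm_coe,
        TensorProduct.norm_tmul, TensorProduct.norm_tmul, ← mul_assoc] at this
    have hleft (x : V) : ‖S x‖ * ‖T‖ ≤ ‖tensorOp S T‖ * ‖x‖ := by
      rw [← norm_norm (S x), ← norm_smul]
      refine ContinuousLinearMap.opNorm_le_bound _ (by positivity) fun y => ?_
      rw [smul_apply, norm_smul, norm_norm]
      exact hsimple x y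
    rw [mul_comm, ← norm_norm T, ← norm_smul]
    refine ContinuousLinearMap.opNorm_le_bound _ (by positivity) fun x => ?_
    rw [smul_apply, norm_smul, norm_norm, mul_comm]
    exact hleft x

instance [Nontrivial V] [Nontrivial W] : Nontrivial (HilbertTensor V W) :=
  (UniformSpace.Completion.coe_injective (V ⊗[ℂ] W)).nontrivial

theorem bellCHSH_eq (A₁ A₂ : V →L[ℂ] V) (B₁ B₂ : W →L[ℂ] W) :
    bellCHSH A₁ A₂ B₁ B₂ = tensorOp A₁ 1 * (tensorOp 1 B₁ + tensorOp 1 B₂)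
      + tensorOp A₂ 1 * (tensorOp 1 B₁ - tensorOp 1 B₂) := by
  simp only [bellCHSH, ← tensorOp_add_right, ← tensorOp_sub_right, tensorOp_mul, mul_one, one_mul]

variable [CompleteSpace V] [CompleteSpace W]

theorem isCHSHTuple_tensorOp {A₁ A₂ : V →L[ℂ] V} {B₁ B₂ : W →L[ℂ] W}
    (hA₁ : IsSelfAdjoint A₁) (hA₁_sq : A₁ ^ 2 = 1) (hA₂ : IsSelfAdjoint A₂) (hA₂_sq : A₂ ^ 2 = 1)
    (hB₁ : IsSelfAdjoint B₁) (hB₁_sq : B₁ ^ 2 = 1) (hB₂ : IsSelfAdjoint B₂)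
    (hB₂_sq : B₂ ^ 2 = 1) :
    IsCHSHTuple (tensorOp A₁ 1) (tensorOp A₂ 1) (tensorOp (1 : V →L[ℂ] V) B₁) (tensorOp 1 B₂) := by
  have hleft_sq {A : V →L[ℂ] V} (hA : A ^ 2 = 1) : tensorOp A (1 : W →L[ℂ] W) ^ 2 = 1 := by
    rw [sq, tensorOp_mul, ← sq A, hA, mul_one, tensorOp_one_one]
  have hright_sq {B : W →L[ℂ] W} (hB : B ^ 2 = 1) : tensorOp (1 : V →L[ℂ] V) B ^ 2 = 1 := by
    rw [sq, tensorOp_mul, ← sq B, hB, mul_one, tensorOp_one_one]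
  exact
    { A₀_inv := hleft_sq hA₁_sq
      A₁_inv := hleft_sq hA₂_sq
      B₀_inv := hright_sq hB₁_sq
      B₁_inv := hright_sq hB₂_sq
      A₀_sa := by rw [star_tensorOp, hA₁.star_eq, star_one]
      A₁_sa := by rw [star_tensorOp, hA₂.star_eq, star_one]
      B₀_sa := by rw [star_tensorOp, hB₁.star_eq, star_one]
      B₁_sa := by rw [star_tensorOp, hB₂.star_eq, star_one]
      A₀B₀_commutes := commute_tensorOp_one_one_tensorOp A₁ B₁
      A₀B₁_commutes := commute_tensorOp_one_one_tensorOp A₁ B₂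
      A₁B₀_commutes := commute_tensorOp_one_one_tensorOp A₂ B₁
      A₁B₁_commutes := commute_tensorOp_one_one_tensorOp A₂ B₂ }

theorem spectralRadius_bellCHSH [Nontrivial V] [Nontrivial W] {A₁ A₂ : V →L[ℂ] V}
    {B₁ B₂ : W →L[ℂ] W} (hA₁ : IsSelfAdjoint A₁) (hA₁_sq : A₁ ^ 2 = 1) (hA₂ : IsSelfAdjoint A₂)
    (hA₂_sq : A₂ ^ 2 = 1) (hB₁ : IsSelfAdjoint B₁) (hB₁_sq : B₁ ^ 2 = 1) (hB₂ : IsSelfAdjoint B₂)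
    (hB₂_sq : B₂ ^ 2 = 1) :
    spectralRadius ℂ (bellCHSH A₁ A₂ B₁ B₂) = ENNReal.ofReal √(4 + ‖⁅A₁, A₂⁆‖ * ‖⁅B₁, B₂⁆‖) := by
  have hchsh := isCHSHTuple_tensorOp hA₁ hA₁_sq hA₂ hA₂_sq hB₁ hB₁_sq hB₂ hB₂_sq
  rw [bellCHSH_eq, spectralRadius_chsh (A := HilbertTensor V W →L[ℂ] HilbertTensor V W) hchsh,
    lie_tensorOp_one_mul_lie_one_tensorOp, norm_tensorOp]

theorem spectralRadius_bellCHSH_reflection [Nontrivial V] [Nontrivial W] {P₁ Q₁ : V →L[ℂ] V}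
    {P₂ Q₂ : W →L[ℂ] W} (hP₁ : IsStarProjection P₁) (hQ₁ : IsStarProjection Q₁)
    (hP₂ : IsStarProjection P₂) (hQ₂ : IsStarProjection Q₂) :
    spectralRadius ℂ (bellCHSH (reflection P₁) (reflection Q₁) (reflection P₂) (reflection Q₂))
      = ENNReal.ofReal √(4 + ‖⁅reflection P₁, reflection Q₁⁆‖ * ‖⁅reflection P₂, reflection Q₂⁆‖) :=
  spectralRadius_bellCHSH (isSelfAdjoint_reflection hP₁.isSelfAdjoint)
    (reflection_sq hP₁.isIdempotentElem) (isSelfAdjoint_reflection hQ₁.isSelfAdjoint)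
    (reflection_sq hQ₁.isIdempotentElem) (isSelfAdjoint_reflection hP₂.isSelfAdjoint)
    (reflection_sq hP₂.isIdempotentElem) (isSelfAdjoint_reflection hQ₂.isSelfAdjoint)
    (reflection_sq hQ₂.isIdempotentElem)

end Tensor

section FiniteDimensional

variable {V : Type*} [NormedAddCommGroup V] [InnerProductSpace ℂ V]

instance (X : FiniteDimPair V) : FiniteDimensional ℂ X.space := X.finiteDimensional

/-- The projection `Pₙ` of a finite dimensional pair as an element of the C⋆-algebra of bounded
operators on its space. -/
def FiniteDimPair.boundedP (X : FiniteDimPair V) : X.space →L[ℂ] X.space :=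
  LinearMap.toContinuousLinearMap X.P

/-- The projection `Qₙ` of a finite dimensional pair as an element of the C⋆-algebra of bounded
operators on its space. -/
def FiniteDimPair.boundedQ (X : FiniteDimPair V) : X.space →L[ℂ] X.space :=
  LinearMap.toContinuousLinearMap X.Q

theorem isStarProjection_boundedP (X : FiniteDimPair V) : IsStarProjection X.boundedP :=
  ContinuousLinearMap.isStarProjection_iff_isSymmetricProjection.2 X.isSymmetricProjection_P

theorem isStarProjection_boundedQ (X : FiniteDimPair V) : IsStarProjection X.boundedQ :=
  ContinuousLinearMap.isStarProjection_iff_isSymmetricProjection.2 X.isSymmetricProjection_Q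

theorem norm_boundedP_le_one (X : FiniteDimPair V) : ‖X.boundedP‖ ≤ 1 :=
  IsStarProjection.norm_le X.boundedP (isStarProjection_boundedP X)

theorem norm_boundedQ_le_one (X : FiniteDimPair V) : ‖X.boundedQ‖ ≤ 1 :=
  IsStarProjection.norm_le X.boundedQ (isStarProjection_boundedQ X)

theorem hasEigenvalue_of_mem_spectrum_sumOp {X : FiniteDimPair V} {l : ℝ}
    (hl : l ∈ spectrum ℝ (sumOp X.boundedP X.boundedQ)) :
    Module.End.HasEigenvalue X.sumOp (l : ℂ) := by
  rw [Module.End.hasEigenvalue_iff_mem_spectrum]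
  rw [← spectrum.algebraMap_mem_iff ℂ, ContinuousLinearMap.spectrum_eq] at hl
  exact hl

theorem norm_lie_reflection_le_b {X : FiniteDimPair V} {l : ℝ} (hl : IsNearestEigenvalue X l) :
    ‖⁅reflection X.boundedP, reflection X.boundedQ⁆‖ ≤ b l := by
  rw [norm_lie_reflection (isStarProjection_boundedP X) (isStarProjection_boundedQ X)]
  refine norm_cfc_le (b_nonneg l) fun m hm => ?_
  rw [Real.norm_of_nonneg (b_nonneg m)]
  exact b_le_b_of_abs_sq_sub_two_le (hl.2 m (hasEigenvalue_of_mem_spectrum_sumOp hm))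

end FiniteDimensional

section StrongConvergence

variable {𝕜 E F ι : Type*} [NontriviallyNormedField 𝕜] [NormedAddCommGroup E] [NormedSpace 𝕜 E]
  [NormedAddCommGroup F] [NormedSpace 𝕜 F] {T : ι → E →L[𝕜] F} {T₀ : E →L[𝕜] F} {l : Filter ι}

theorem uniformEquicontinuous_of_norm_le {C : ℝ} (hT : ∀ i, ‖T i‖ ≤ C) :
    UniformEquicontinuous fun i => (T i : E → F) :=
  LipschitzWith.uniformEquicontinuous _ C.toNNReal fun i =>
    ContinuousLinearMap.lipschitzWith_of_opNorm_le ((hT i).trans (Real.le_coe_toNNReal C))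

theorem tendsto_apply_of_dense_span {C : ℝ} (hT : ∀ i, ‖T i‖ ≤ C) {s : Set E}
    (hs : Dense (Submodule.span 𝕜 s : Set E))
    (h : ∀ x ∈ s, Tendsto (fun i => T i x) l (𝓝 (T₀ x))) (x : E) :
    Tendsto (fun i => T i x) l (𝓝 (T₀ x)) := by
  have hclosed : IsClosed {x | Tendsto (fun i => T i x) l (𝓝 (T₀ x))} :=
    (uniformEquicontinuous_of_norm_le hT).equicontinuous.isClosed_setOfPred_tendsto T₀.continuous
  refine hs.induction (fun x hx => ?_) hclosed x
  induction hx using Submodule.span_induction with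
  | mem x hx => exact h x hx
  | zero => simpa only [map_zero] using tendsto_const_nhds
  | add x y _ _ hx hy => simpa only [map_add] using hx.add hy
  | smul c x _ hx => simpa only [map_smul] using hx.const_smul c

theorem tendsto_apply_apply_of_norm_le {C : ℝ} (hT : ∀ i, ‖T i‖ ≤ C) {x : ι → E} {x₀ : E} {y : F}
    (hy : Tendsto (fun i => T i x₀) l (𝓝 y)) (hx : Tendsto x l (𝓝 x₀)) :
    Tendsto (fun i => T i (x i)) l (𝓝 y) := by
  have hdiff : Tendsto (fun i => T i (x i - x₀)) l (𝓝 0) := by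
    refine squeeze_zero_norm (fun i => (T i).le_of_opNorm_le (hT i) _) ?_
    simpa only [sub_self, norm_zero, mul_zero] using (hx.sub_const x₀).norm.const_mul C
  simpa only [map_sub, sub_add_cancel, zero_add] using hdiff.add hy

theorem eventually_lt_opNorm_of_tendsto_apply (h : ∀ x, Tendsto (fun i => T i x) l (𝓝 (T₀ x)))
    {c : ℝ} (hc : c < ‖T₀‖) : ∀ᶠ i in l, c < ‖T i‖ := by
  rcases lt_or_ge c 0 with hneg | hnonneg
  · exact .of_forall fun i => hneg.trans_le (norm_nonneg _)
  obtain ⟨x, hx⟩ : ∃ x, c * ‖x‖ < ‖T₀ x‖ := by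
    by_contra! hle
    exact hc.not_ge (T₀.opNorm_le_bound hnonneg hle)
  filter_upwards [(h x).norm.eventually_const_lt hx] with i hi
  exact lt_of_mul_lt_mul_right (hi.trans_le ((T i).le_opNorm x)) (norm_nonneg x)

theorem tendsto_min_of_eventually_lt {α : Type*} [LinearOrder α] [TopologicalSpace α]
    [OrderTopology α] {a : α} {f : ι → α} (h : ∀ c < a, ∀ᶠ i in l, c < f i) :
    Tendsto (fun i => min a (f i)) l (𝓝 a) :=
  tendsto_order.2 ⟨fun c hc => (h c hc).mono fun _ hi => lt_min hc hi,
    fun _ hc => .of_forall fun _ => (min_le_left _ _).trans_lt hc⟩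

end StrongConvergence

section ExtendByZero

variable {V : Type*} [NormedAddCommGroup V] [InnerProductSpace ℂ V] {U : Submodule ℂ V}
  [U.HasOrthogonalProjection]

/-- The operator on `V` that acts as `T` on the subspace `U` and as zero on its orthogonal
complement. It brings operators on different subspaces of `V` into one operator algebra. -/
def extendByZero (T : U →L[ℂ] U) : V →L[ℂ] V :=
  U.subtypeL ∘L T ∘L U.orthogonalProjectionOnto

theorem extendByZero_apply (T : U →L[ℂ] U) (x : V) :
    extendByZero T x = T (U.orthogonalProjectionOnto x) := rfl

theorem extendByZero_apply_coe (T : U →L[ℂ] U) (x : U) : extendByZero T x = T x := by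
  rw [extendByZero_apply, Submodule.orthogonalProjectionOnto_mem_subspace_eq_self]

theorem extendByZero_lie (S T : U →L[ℂ] U) :
    extendByZero ⁅S, T⁆ = ⁅extendByZero S, extendByZero T⁆ := by
  ext x
  simp only [Ring.lie_def, extendByZero_apply, sub_apply, mul_apply_eq_comp, Submodule.coe_sub,
    Submodule.orthogonalProjectionOnto_mem_subspace_eq_self]

theorem extendByZero_reflection (P : U →L[ℂ] U) :
    extendByZero (reflection P) = (2 : ℂ) • extendByZero P - U.starProjection := by
  ext x
  simp only [reflection, extendByZero_apply, sub_apply, smul_apply, Submodule.coe_sub,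
    Submodule.coe_smul, ContinuousLinearMap.id_apply, Submodule.starProjection_apply]

theorem norm_extendByZero_le (T : U →L[ℂ] U) : ‖extendByZero T‖ ≤ ‖T‖ :=
  ContinuousLinearMap.opNorm_le_bound _ (norm_nonneg T) fun x =>
    T.le_opNorm_of_le (U.norm_orthogonalProjectionOnto_apply_le x)

theorem tendsto_extendByZero_of_dense_span {ι : Type*} {l : Filter ι} {U : ι → Submodule ℂ V}
    [∀ i, (U i).HasOrthogonalProjection] {T : ∀ i, U i →L[ℂ] U i} {T₀ : V →L[ℂ] V} {C : ℝ}
    (hT : ∀ i, ‖T i‖ ≤ C) {s : Set V} (hs : Dense (Submodule.span ℂ s : Set V))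
    (h : ∀ x ∈ s, ∀ᶠ i in l, ∃ y : U i, (y : V) = x ∧ (T i y : V) = T₀ x) (x : V) :
    Tendsto (fun i => extendByZero (T i) x) l (𝓝 (T₀ x)) := by
  refine tendsto_apply_of_dense_span (fun i => (norm_extendByZero_le (T i)).trans (hT i)) hs
    (fun x hx => tendsto_const_nhds.congr' ?_) x
  filter_upwards [h x hx] with i ⟨y, hyx, hTy⟩
  rw [← hTy, ← hyx, extendByZero_apply_coe]

end ExtendByZero

section ConvergesStrongly

variable {V : Type*} [NormedAddCommGroup V] [InnerProductSpace ℂ V] {P Q : V →L[ℂ] V}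
  {𝒜 : ℕ → FiniteDimPair V}

/-- The finite dimensional pairs `𝒜 n` approximate `(P, Q)` in the strong operator topology: the
orthogonal projections onto the spaces of `𝒜` converge pointwise to the identity, and the
projections of `𝒜`, extended by zero, converge pointwise to `P` and `Q`. -/
structure ConvergesStrongly (P Q : V →L[ℂ] V) (𝒜 : ℕ → FiniteDimPair V) : Prop where
  tendsto_space : ∀ x, Tendsto (fun n => (𝒜 n).space.starProjection x) atTop (𝓝 x)
  tendsto_P : ∀ x, Tendsto (fun n => extendByZero (𝒜 n).boundedP x) atTop (𝓝 (P x))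
  tendsto_Q : ∀ x, Tendsto (fun n => extendByZero (𝒜 n).boundedQ x) atTop (𝓝 (Q x))

theorem norm_extendByZero_reflection_le_one {U : Submodule ℂ V} [CompleteSpace U] {p : U →L[ℂ] U}
    (hp : IsStarProjection p) : ‖extendByZero (reflection p)‖ ≤ 1 :=
  (norm_extendByZero_le _).trans (norm_reflection_le_one hp)

theorem ConvergesStrongly.tendsto_reflection_P (h : ConvergesStrongly P Q 𝒜) (x : V) :
    Tendsto (fun n => extendByZero (reflection (𝒜 n).boundedP) x) atTop (𝓝 (reflection P x)) := by
  simp only [extendByZero_reflection]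
  exact ((h.tendsto_P x).const_smul 2).sub (h.tendsto_space x)

theorem ConvergesStrongly.tendsto_reflection_Q (h : ConvergesStrongly P Q 𝒜) (x : V) :
    Tendsto (fun n => extendByZero (reflection (𝒜 n).boundedQ) x) atTop (𝓝 (reflection Q x)) := by
  simp only [extendByZero_reflection]
  exact ((h.tendsto_Q x).const_smul 2).sub (h.tendsto_space x)

theorem ConvergesStrongly.tendsto_lie_reflection (h : ConvergesStrongly P Q 𝒜) (x : V) :
    Tendsto (fun n => extendByZero ⁅reflection (𝒜 n).boundedP, reflection (𝒜 n).boundedQ⁆ x) atTop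
      (𝓝 (⁅reflection P, reflection Q⁆ x)) := by
  have hA (n) := norm_extendByZero_reflection_le_one (isStarProjection_boundedP (𝒜 n))
  have hB (n) := norm_extendByZero_reflection_le_one (isStarProjection_boundedQ (𝒜 n))
  simp only [extendByZero_lie]
  simp only [Ring.lie_def, sub_apply, mul_apply_eq_comp]
  exact (tendsto_apply_apply_of_norm_le hA (h.tendsto_reflection_P _)
    (h.tendsto_reflection_Q x)).sub
    (tendsto_apply_apply_of_norm_le hB (h.tendsto_reflection_Q _) (h.tendsto_reflection_P x))

theorem ConvergesStrongly.eventually_lt_b (h : ConvergesStrongly P Q 𝒜) {lam : ℕ → ℝ}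
    (hlam : ∀ᶠ n in atTop, IsNearestEigenvalue (𝒜 n) (lam n)) {c : ℝ}
    (hc : c < ‖⁅reflection P, reflection Q⁆‖) : ∀ᶠ n in atTop, c < b (lam n) := by
  filter_upwards [hlam, eventually_lt_opNorm_of_tendsto_apply h.tendsto_lie_reflection hc]
    with n hn hcn
  exact hcn.trans_le ((norm_extendByZero_le _).trans (norm_lie_reflection_le_b hn))

theorem ConvergesStrongly.tendsto_min_norm_b (h : ConvergesStrongly P Q 𝒜) {lam : ℕ → ℝ}
    (hlam : ∀ᶠ n in atTop, IsNearestEigenvalue (𝒜 n) (lam n)) :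
    Tendsto (fun n => min ‖⁅reflection P, reflection Q⁆‖ (b (lam n))) atTop
      (𝓝 ‖⁅reflection P, reflection Q⁆‖) :=
  tendsto_min_of_eventually_lt fun _ => h.eventually_lt_b hlam

theorem ConvergesStrongly.of_dense_span {s : Set V} (hs : Dense (Submodule.span ℂ s : Set V))
    (h : ∀ x ∈ s, ∀ᶠ n in atTop, ∃ y : (𝒜 n).space, (y : V) = x ∧
      ((𝒜 n).P y : V) = P x ∧ ((𝒜 n).Q y : V) = Q x) : ConvergesStrongly P Q 𝒜 where
  tendsto_space := by
    refine tendsto_apply_of_dense_span (T₀ := .id ℂ V)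
      (fun n => (𝒜 n).space.starProjection_norm_le) hs fun x hx => ?_
    refine tendsto_const_nhds.congr' ?_
    filter_upwards [h x hx] with n ⟨y, hyx, _, _⟩
    rw [← hyx]
    exact (Submodule.starProjection_eq_self_iff.2 y.2).symm
  tendsto_P := tendsto_extendByZero_of_dense_span
    (fun n => norm_boundedP_le_one (𝒜 n)) hs fun x hx =>
      (h x hx).mono fun n ⟨y, hyx, hPy, _⟩ => ⟨y, hyx, hPy⟩
  tendsto_Q := tendsto_extendByZero_of_dense_span
    (fun n => norm_boundedQ_le_one (𝒜 n)) hs fun x hx =>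
      (h x hx).mono fun n ⟨y, hyx, _, hQy⟩ => ⟨y, hyx, hQy⟩

theorem IsDecompositionApprox.convergesStrongly {ι : Type} {W : ι → Submodule ℂ V}
    {I : ℕ → Finset ι} (hW : (⨆ i, W i).topologicalClosure = ⊤)
    (h : IsDecompositionApprox P Q W I 𝒜) : ConvergesStrongly P Q 𝒜 := by
  rw [Submodule.iSup_eq_span, ← Submodule.dense_iff_topologicalClosure_eq_top] at hW
  refine .of_dense_span hW fun x hx => ?_
  obtain ⟨i, hxi⟩ := Set.mem_iUnion.1 hx
  obtain ⟨m, him⟩ := h.exhaust i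
  filter_upwards [eventually_ge_atTop m] with n hmn
  have hx_mem : x ∈ (𝒜 n).space := by
    rw [h.space_eq]
    exact Submodule.mem_iSup_of_mem i (Submodule.mem_iSup_of_mem (h.monotone hmn him) hxi)
  exact ⟨⟨x, hx_mem⟩, rfl, h.P_apply n _, h.Q_apply n _⟩

theorem IsOneShiftedApprox.convergesStrongly {e : HilbertBasis ℕ ℂ V}
    (h : IsOneShiftedApprox P Q e 𝒜) : ConvergesStrongly P Q 𝒜 := by
  refine .of_dense_span (Submodule.dense_iff_topologicalClosure_eq_top.2 e.dense_span) ?_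
  rintro _ ⟨j, rfl⟩
  filter_upwards [eventually_ge_atTop j] with n hjn
  have hej_mem : e j ∈ (𝒜 n).space := by
    rw [h.space_eq]
    exact Submodule.subset_span (Set.mem_image_of_mem e (show j < 2 * (n + 1) by lia))
  exact ⟨⟨e j, hej_mem⟩, rfl, h.P_apply n _, h.Q_apply n j (by lia) _ rfl⟩

theorem IsCanonicalApprox.convergesStrongly (h : IsCanonicalApprox P Q 𝒜) :
    ConvergesStrongly P Q 𝒜 := by
  cases h with
  | decomposition _ _ _ _ hW h𝒜 => exact h𝒜.convergesStrongly hW.dense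
  | oneShifted _ _ _ _ h𝒜 => exact h𝒜.convergesStrongly

end ConvergesStrongly

end BellCHSH

end

theorem mainTheorem3_general
    {V₁ : Type*} [NormedAddCommGroup V₁] [InnerProductSpace ℂ V₁] [CompleteSpace V₁]
    [Nontrivial V₁]
    {V₂ : Type*} [NormedAddCommGroup V₂] [InnerProductSpace ℂ V₂] [CompleteSpace V₂]
    [Nontrivial V₂]
    (P₁ Q₁ : V₁ →L[ℂ] V₁) (hP₁ : IsStarProjection P₁) (hQ₁ : IsStarProjection Q₁)
    (P₂ Q₂ : V₂ →L[ℂ] V₂) (hP₂ : IsStarProjection P₂) (hQ₂ : IsStarProjection Q₂)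
    (𝒜₁ : ℕ → BellCHSH.FiniteDimPair V₁) (h𝒜₁ : BellCHSH.ConvergesStrongly P₁ Q₁ 𝒜₁)
    (𝒜₂ : ℕ → BellCHSH.FiniteDimPair V₂) (h𝒜₂ : BellCHSH.ConvergesStrongly P₂ Q₂ 𝒜₂)
    (lam₁ lam₂ : ℕ → ℝ)
    (hlam₁ : ∀ᶠ n in atTop, BellCHSH.IsNearestEigenvalue (𝒜₁ n) (lam₁ n))
    (hlam₂ : ∀ᶠ n in atTop, BellCHSH.IsNearestEigenvalue (𝒜₂ n) (lam₂ n)) :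
    (⨆ l ∈ insert 0 (BellCHSH.finDimApproxPointSpectrum P₁ Q₁ 𝒜₁),
        ⨆ l' ∈ insert 0 (BellCHSH.finDimApproxPointSpectrum P₂ Q₂ 𝒜₂),
          ENNReal.ofReal √(4 + BellCHSH.b l * BellCHSH.b l'))
      ≤ spectralRadius ℂ (BellCHSH.bellCHSH
          (BellCHSH.reflection P₁) (BellCHSH.reflection Q₁)
          (BellCHSH.reflection P₂) (BellCHSH.reflection Q₂)) ∧
    spectralRadius ℂ (BellCHSH.bellCHSH
          (BellCHSH.reflection P₁) (BellCHSH.reflection Q₁)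
          (BellCHSH.reflection P₂) (BellCHSH.reflection Q₂))
      ≤ liminf (fun n => ENNReal.ofReal √(4 + BellCHSH.b (lam₁ n) * BellCHSH.b (lam₂ n)))
          atTop := by
  rw [BellCHSH.spectralRadius_bellCHSH_reflection hP₁ hQ₁ hP₂ hQ₂]
  constructor
  · refine iSup₂_le fun l hl => iSup₂_le fun l' hl' => ?_
    gcongr
    · exact BellCHSH.b_nonneg _
    · exact BellCHSH.b_le_norm_lie_reflection hP₁ hQ₁ hl
    · exact BellCHSH.b_le_norm_lie_reflection hP₂ hQ₂ hl'
  · have hmin := ENNReal.tendsto_ofReal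
      (((h𝒜₁.tendsto_min_norm_b hlam₁).mul (h𝒜₂.tendsto_min_norm_b hlam₂)).const_add 4).sqrt
    rw [← hmin.liminf_eq]
    refine liminf_le_liminf (.of_forall fun n => ?_)
    gcongr
    · exact le_min (norm_nonneg _) (BellCHSH.b_nonneg _)
    · exact BellCHSH.b_nonneg _
    · exact min_le_right _ _
    · exact min_le_right _ _

theorem mainTheorem3
    {V₁ : Type*} [NormedAddCommGroup V₁] [InnerProductSpace ℂ V₁] [CompleteSpace V₁]
    [TopologicalSpace.SeparableSpace V₁] [Nontrivial V₁]
    {V₂ : Type*} [NormedAddCommGroup V₂] [InnerProductSpace ℂ V₂] [CompleteSpace V₂]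
    [TopologicalSpace.SeparableSpace V₂] [Nontrivial V₂]
    (P₁ Q₁ : V₁ →L[ℂ] V₁) (hP₁ : IsStarProjection P₁) (hQ₁ : IsStarProjection Q₁)
    (P₂ Q₂ : V₂ →L[ℂ] V₂) (hP₂ : IsStarProjection P₂) (hQ₂ : IsStarProjection Q₂)
    (𝒜₁ : ℕ → BellCHSH.FiniteDimPair V₁) (h𝒜₁ : BellCHSH.IsCanonicalApprox P₁ Q₁ 𝒜₁)
    (𝒜₂ : ℕ → BellCHSH.FiniteDimPair V₂) (h𝒜₂ : BellCHSH.IsCanonicalApprox P₂ Q₂ 𝒜₂)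
    (lam₁ lam₂ : ℕ → ℝ)
    (hlam₁ : ∀ᶠ n in atTop, BellCHSH.IsNearestEigenvalue (𝒜₁ n) (lam₁ n))
    (hlam₂ : ∀ᶠ n in atTop, BellCHSH.IsNearestEigenvalue (𝒜₂ n) (lam₂ n)) :
    (⨆ l ∈ BellCHSH.Ftilde P₁ Q₁ 𝒜₁, ⨆ l' ∈ BellCHSH.Ftilde P₂ Q₂ 𝒜₂,
        ENNReal.ofReal √(4 + BellCHSH.b l * BellCHSH.b l'))
      ≤ spectralRadius ℂ (BellCHSH.bellCHSH
          (BellCHSH.reflection P₁) (BellCHSH.reflection Q₁)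
          (BellCHSH.reflection P₂) (BellCHSH.reflection Q₂)) ∧
    spectralRadius ℂ (BellCHSH.bellCHSH
          (BellCHSH.reflection P₁) (BellCHSH.reflection Q₁)
          (BellCHSH.reflection P₂) (BellCHSH.reflection Q₂))
      ≤ liminf (fun n => ENNReal.ofReal √(4 + BellCHSH.b (lam₁ n) * BellCHSH.b (lam₂ n)))
          atTop := by
  have h := mainTheorem3_general P₁ Q₁ hP₁ hQ₁ P₂ Q₂ hP₂ hQ₂ 𝒜₁ h𝒜₁.convergesStrongly
    𝒜₂ h𝒜₂.convergesStrongly lam₁ lam₂ hlam₁ hlam₂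
  exact ⟨(biSup_mono BellCHSH.Ftilde_subset).trans
    ((iSup₂_mono fun _ _ => biSup_mono BellCHSH.Ftilde_subset).trans h.1), h.2⟩
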